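/- Let $a\ge 1$ be an integer and consider an urn that initially holds $W(0)$ white and $B(0)$ blue balls, with differential index $\Delta := B(0)-W(0)\ge 1$. Its replacement matrix is $$\begin{pmatrix} -a & -a\\ a & a\end{pmatrix},$$ that is, when a white ball is drawn, $a$ white and $a$ blue balls are removed from the urn, and when a blue ball is drawn, $a$ white and $a$ blue balls are added. Assume that the urn is tenable: on every possible sequence of draws the numbers of balls of both colours stay nonnegative and the urn never gets empty. The associated (constant-differentials) Pólya process in continuous time is as follows. Between two epochs every ball in the urn carries a clock that rings after an $\mathrm{Exp}(1)$ time, these clocks being independent of each other and of the past of the process; when the first of the clocks rings (an epoch), the ball that owns it is drawn and the replacement rule is executed instantaneously. Let $W(t)$ be the number of white balls in the urn at time $t$. Then for every $t\ge 0$ the variable $W(t)$ has a finite second moment, and $$\mathbb{E}[W(t)] = W(0) + a\Delta t,\qquad \mathbb{V}\mathrm{ar}[W(t)] = a^2 t\,\bigl(2W(0)+\Delta+a\Delta t\bigr).$$ -/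

import Mathlib

open MeasureTheory ProbabilityTheory

namespace PolyaProcess

/-- The contents of an urn: `x 0` white balls and `x 1` blue balls. -/
abbrev Urn := Fin 2 → ℤ

/-- A label for a ball: its colour (`0` is white, `1` is blue) and a serial number within that
colour. -/
abbrev Ball := Fin 2 × ℕ

/-- The balls that are in an urn with contents `x`: there are `x c` of them of each colour `c`. -/
def balls (x : Urn) : Set Ball := {p | (p.2 : ℤ) < x p.1}

/-- The contents that can occur when the discrete urn scheme with replacement matrix `M` starts
from `x₀`. When a ball of colour `c` is drawn, the row `M c` is added to the contents. -/
inductive Reachable (M : Matrix (Fin 2) (Fin 2) ℤ) (x₀ : Urn) : Urn → Prop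
  | start : Reachable M x₀ x₀
  | draw {x : Urn} (c : Fin 2) (hx : Reachable M x₀ x) (hc : 0 < x c) : Reachable M x₀ (x + M c)

/-- Tenability: on all possible paths, the urn never has a negative number of balls of some
colour (so there always are enough balls to be removed), and it never gets empty. -/
def Tenable (M : Matrix (Fin 2) (Fin 2) ℤ) (x₀ : Urn) : Prop :=
  ∀ x, Reachable M x₀ x → (∀ c, 0 ≤ x c) ∧ 0 < x 0 + x 1

/-- The time until the first clock rings, if the ball `p` has a clock that rings after time
`r p`. -/
noncomputable def waitingTime (x : Urn) (r : Ball → ℝ) : ℝ := sInf (r '' balls x)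

open Classical in
/-- The colour of the ball whose clock rings first. (Ties have probability zero.) -/
noncomputable def drawnColour (x : Urn) (r : Ball → ℝ) : Fin 2 :=
  if ∃ p ∈ balls x, p.1 = 0 ∧ r p = waitingTime x r then 0 else 1

/-- The time of the `n`-th epoch, and the contents of the urn just after it. Here `r n p` is the
time from the `n`-th epoch until the clock of the ball `p` rings. At every epoch the rule of the
replacement matrix `M` is executed, without any time lapse. -/
noncomputable def epoch (M : Matrix (Fin 2) (Fin 2) ℤ) (x₀ : Urn) (r : ℕ → Ball → ℝ) :
    ℕ → ℝ × Urn
  | 0 => (0, x₀)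
  | n + 1 =>
    ((epoch M x₀ r n).1 + waitingTime (epoch M x₀ r n).2 (r n),
      (epoch M x₀ r n).2 + M (drawnColour (epoch M x₀ r n).2 (r n)))

/-- The number of epochs in the time interval from `0` to `t`. -/
noncomputable def epochCount (M : Matrix (Fin 2) (Fin 2) ℤ) (x₀ : Urn) (r : ℕ → Ball → ℝ)
    (t : ℝ) : ℕ :=
  sSup {n | (epoch M x₀ r n).1 ≤ t}

/-- The contents of the urn at time `t`. -/
noncomputable def urnAt (M : Matrix (Fin 2) (Fin 2) ℤ) (x₀ : Urn) (r : ℕ → Ball → ℝ)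
    (t : ℝ) : Urn :=
  (epoch M x₀ r (epochCount M x₀ r t)).2

/-- The random clocks of a Pólya process: after each epoch `n`, the times `ξ n p` until the
clocks of the balls ring are `Exp(1)` variables, independent of each other and of the past of the
process, that is, of the epochs up to the `n`-th and the contents of the urn at them.

It is left open whether, at an epoch, the clock of a ball that stays in the urn goes on running
(then `ξ n p` is its residual time, which has these properties as exponential variables have no
memory) or is set anew. -/
structure IsClockSystem {Ω : Type*} [MeasurableSpace Ω] (μ : Measure Ω)
    (M : Matrix (Fin 2) (Fin 2) ℤ) (x₀ : Urn) (ξ : ℕ → Ball → Ω → ℝ) : Prop where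
  measurable : ∀ n p, Measurable (ξ n p)
  law : ∀ n p, μ.map (ξ n p) = expMeasure 1
  indep : ∀ n, iIndepFun (ξ n) μ
  indep_past : ∀ n, IndepFun
    (fun ω (k : Fin (n + 1)) => epoch M x₀ (fun m p => ξ m p ω) k)
    (fun ω p => ξ n p ω) μ

/-- The replacement matrix of the constant-differentials urn. -/
def constDiffMatrix (a : ℕ) : Matrix (Fin 2) (Fin 2) ℤ :=
  !![-(a : ℤ), -(a : ℤ); (a : ℤ), (a : ℤ)]

end PolyaProcess

namespace PolyaProcess

open scoped ENNReal

/-! ### Exponential clocks -/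

/-! Both rows of the matrix preserve the difference blue minus white, so the white count alone is a
Markov chain: it jumps from `x` to `x + a` at rate `x + Δ` and to `x - a` at rate `x`. If `h v x`
solves the backward equation of this chain, then `h (t - s) (W s)` is a martingale in `s`, whence
E[h 0 (W t)] = h t (W 0). Two explicit polynomial solutions, with initial values `x` and `x ^ 2`,
give the two moments.

The martingale argument runs along the epochs. Let T_n be the time of epoch n and W_n the white
count after it. Put A_n = E[h (t - T_n) W_n; T_n ≤ t] and D_n = E[h 0 W_n; T_n ≤ t < T_{n+1}].
Conditioning on the next ring (`lintegral_waitingTime_drawnColour`,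
`IsBackwardSolution.lintegral_eq`) gives A_n = A_{n+1} + D_n. The D_n add up to the expectation at
time t, provided that the process does not explode and that A_n → 0.

Both provisos follow from one supermartingale, (n + 1 + W_n)^3 exp(-c T_n) with `c` large
(`supermartingale_step`). On T_n ≤ t the discount is bounded below, and one of the three powers can
be traded for a factor n + 1, so E[(1 + W_n)^2; T_n ≤ t] = O(1/n). This quadratic weight dominates
both polynomial solutions. All expectations are lower integrals of nonnegative functions, so
integrability is a result and not a prerequisite. -/

lemma lintegral_expMeasure_one {φ : ℝ → ℝ≥0∞} (hφ : Measurable φ) :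
    ∫⁻ r, φ r ∂(expMeasure 1) = ∫⁻ r in Set.Ioi 0, φ r * ENNReal.ofReal (Real.exp (-r)) := by
  have hm : Measurable (exponentialPDF 1) :=
    (measurable_exponentialPDFReal 1).ennreal_ofReal
  have h1 : expMeasure 1 = volume.withDensity (exponentialPDF 1) := rfl
  rw [h1, lintegral_withDensity_eq_lintegral_mul _ hm hφ, ← lintegral_indicator measurableSet_Ioi]
  refine lintegral_congr_ae ?_
  -- The density is positive at 0, which `Set.Ioi 0` leaves out; a single point is null.
  have h0 : ∀ᵐ r : ℝ, r ≠ 0 := by simp [ae_iff]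
  filter_upwards [h0] with r hr
  rcases lt_or_gt_of_ne hr with h | h
  · simp [exponentialPDF_of_neg h, h.le]
  · simp [exponentialPDF_of_nonneg h.le, h, mul_comm]

lemma expMeasure_one_Ioi {r : ℝ} (hr : 0 ≤ r) :
    expMeasure 1 (Set.Ioi r) = ENNReal.ofReal (Real.exp (-r)) := by
  have := isProbabilityMeasure_expMeasure one_pos
  have h1 : expMeasure 1 (Set.Iic r) = ENNReal.ofReal (1 - Real.exp (-r)) := by
    rw [← ofReal_cdf, cdf_expMeasure_eq one_pos, if_pos hr, one_mul]
  rw [← Set.compl_Iic, prob_compl_eq_one_sub measurableSet_Iic, h1, ← ENNReal.ofReal_one,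
    ← ENNReal.ofReal_sub _ (by simpa using hr)]
  simp

lemma lintegral_exp_neg_mul_Ioi {l : ℝ} (hl : 0 < l) (u : ℝ) :
    ∫⁻ r in Set.Ioi u, ENNReal.ofReal (Real.exp (-(l * r)))
      = ENNReal.ofReal (Real.exp (-(l * u)) / l) := by
  have h := integral_exp_mul_Ioi (neg_lt_zero.2 hl) u
  have hi := integrableOn_exp_mul_Ioi (neg_lt_zero.2 hl) u
  simp only [neg_mul] at h hi
  rw [← ofReal_integral_eq_lintegral_ofReal hi (.of_forall fun _ => (Real.exp_pos _).le), h,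
    neg_div_neg_eq]

/-- Tonelli on the product law: the past is frozen at `X ω` while the fresh clocks are averaged. -/
lemma lintegral_of_indepFun {Ω α β : Type*} [MeasurableSpace Ω] [MeasurableSpace α]
    [MeasurableSpace β] {μ : Measure Ω} [IsProbabilityMeasure μ] {X : Ω → α} {Y : Ω → β}
    (hX : Measurable X) (hY : Measurable Y) (hXY : IndepFun X Y μ) {F : α × β → ℝ≥0∞}
    (hF : Measurable F) :
    ∫⁻ ω, F (X ω, Y ω) ∂μ = ∫⁻ ω, ∫⁻ ω', F (X ω, Y ω') ∂μ ∂μ := by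
  have h := (indepFun_iff_map_prod_eq_prod_map_map hX.aemeasurable hY.aemeasurable).1 hXY
  have := Measure.isProbabilityMeasure_map (μ := μ) hY.aemeasurable
  rw [← lintegral_map hF (hX.prodMk hY), h, lintegral_prod _ hF.aemeasurable,
    lintegral_map hF.lintegral_prod_right' hX]
  refine lintegral_congr fun ω => ?_
  rw [lintegral_map (f := fun y => F (X ω, y)) (hF.comp measurable_prodMk_left) hY]

/-- The event that the clock `p` is the only one of the clocks in `S` that rings first. -/
def firstAlone {Ω ι : Type*} (η : ι → Ω → ℝ) (S : Finset ι) (p : ι) : Set Ω :=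
  {ω | ∀ q ∈ S, q ≠ p → η p ω < η q ω}

lemma measurableSet_firstAlone {Ω ι : Type*} [MeasurableSpace Ω] {η : ι → Ω → ℝ}
    (hm : ∀ p, Measurable (η p)) (S : Finset ι) (p : ι) :
    MeasurableSet (firstAlone η S p) := by
  have : firstAlone η S p = ⋂ q ∈ S, ⋂ _ : q ≠ p, {ω | η p ω < η q ω} := by
    ext; simp [firstAlone]
  rw [this]
  exact Finset.measurableSet_biInter _ fun q _ =>
    MeasurableSet.iInter fun _ => measurableSet_lt (hm p) (hm q)

/-! ### The race of finitely many independent exponential clocks -/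

section Race

variable {Ω ι : Type*} [MeasurableSpace Ω] {μ : Measure Ω} [IsProbabilityMeasure μ]
  {η : ι → Ω → ℝ}

/-- Given that clock `p` rings at time `r`, each of the other `S.card - 1` clocks is later with
probability exp(-r); the density exp(-r) of `p` itself supplies the last factor of exp(-S.card * r).
-/
lemma lintegral_indicator_firstAlone (hm : ∀ p, Measurable (η p))
    (hlaw : ∀ p, μ.map (η p) = expMeasure 1) (hind : iIndepFun η μ) (S : Finset ι) {p : ι}
    (hp : p ∈ S) {φ : ℝ → ℝ≥0∞} (hφ : Measurable φ) :
    ∫⁻ ω, (firstAlone η S p).indicator (fun ω => φ (η p ω)) ω ∂μ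
      = ∫⁻ r in Set.Ioi 0, φ r * ENNReal.ofReal (Real.exp (-(S.card * r))) := by
  classical
  have hI : IndepFun (η p) (fun ω (q : S.erase p) => η q ω) μ := by
    have := hind.indepFun_finset {p} (S.erase p) (by simp) hm
    exact this.comp (φ := fun z : ((i : ({p} : Finset ι)) → ℝ) => z ⟨p, by simp⟩) (ψ := id)
      (measurable_pi_apply _) measurable_id
  have hY : Measurable (fun ω (q : S.erase p) => η q ω) := measurable_pi_lambda _ fun q => hm q
  have hA : MeasurableSet {z : ℝ × (S.erase p → ℝ) | ∀ q, z.1 < z.2 q} := by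
    rw [Set.ofPred_forall]
    exact MeasurableSet.iInter fun q => measurableSet_lt measurable_fst
      ((measurable_pi_apply q).comp measurable_snd)
  have hF : Measurable (Set.indicator {z : ℝ × (S.erase p → ℝ) | ∀ q, z.1 < z.2 q}
      (fun z => φ z.1)) := (hφ.comp measurable_fst).indicator hA
  have e1 : ∀ ω, (firstAlone η S p).indicator (fun ω => φ (η p ω)) ω
      = Set.indicator {z : ℝ × (S.erase p → ℝ) | ∀ q, z.1 < z.2 q} (fun z => φ z.1)
        (η p ω, fun q => η q ω) := by
    intro ω
    simp only [Set.indicator_apply, firstAlone, Set.mem_ofPred_eq, Subtype.forall,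
      Finset.mem_erase]
    congr 1
    apply propext
    grind
  have e2 : ∀ r : ℝ, ∫⁻ ω', Set.indicator {z : ℝ × (S.erase p → ℝ) | ∀ q, z.1 < z.2 q}
      (fun z => φ z.1) (r, fun q => η q ω') ∂μ = φ r * ∏ q ∈ S.erase p, expMeasure 1 (Set.Ioi r) := by
    intro r
    have hB : MeasurableSet (⋂ q ∈ S.erase p, η q ⁻¹' Set.Ioi r) :=
      Finset.measurableSet_biInter _ fun q _ => hm q measurableSet_Ioi
    have : ∀ ω', Set.indicator {z : ℝ × (S.erase p → ℝ) | ∀ q, z.1 < z.2 q}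
      (fun z => φ z.1) (r, fun q => η q ω')
        = (⋂ q ∈ S.erase p, η q ⁻¹' Set.Ioi r).indicator (fun _ => φ r) ω' := by
      intro ω'
      simp only [Set.indicator_apply, Set.mem_ofPred_eq, Subtype.forall, Set.mem_iInter,
        Set.mem_preimage, Set.mem_Ioi]
    rw [lintegral_congr this, lintegral_indicator hB, setLIntegral_const,
      hind.measure_inter_preimage_eq_mul _ fun _ _ => measurableSet_Ioi]
    congr 1
    refine Finset.prod_congr rfl fun q _ => ?_
    rw [← hlaw q, Measure.map_apply (hm q) measurableSet_Ioi]
  have hmeas : Measurable fun r : ℝ => φ r * ∏ q ∈ S.erase p, expMeasure 1 (Set.Ioi r) := by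
    -- By Tonelli, the partial integral of a jointly measurable integrand is measurable in `r`.
    have := hF.lintegral_prod_right' (ν := μ.map fun ω (q : S.erase p) => η q ω)
    convert this using 2 with r
    exact (e2 r).symm.trans (lintegral_map (hF.comp measurable_prodMk_left) hY).symm
  rw [lintegral_congr e1, lintegral_of_indepFun (hm p) hY hI hF, lintegral_congr fun ω => e2 _,
    ← lintegral_map (f := fun r => φ r * ∏ q ∈ S.erase p, expMeasure 1 (Set.Ioi r)) hmeas (hm p),
    hlaw, lintegral_expMeasure_one hmeas]
  refine setLIntegral_congr_fun measurableSet_Ioi fun r hr => ?_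
  have hr' : 0 ≤ r := le_of_lt hr
  simp only [Finset.prod_const, expMeasure_one_Ioi hr']
  rw [mul_assoc, ← pow_succ, Finset.card_erase_add_one hp, ← ENNReal.ofReal_pow (Real.exp_pos _).le,
    ← Real.exp_nat_mul]
  congr 4
  ring

/-- The events are disjoint and each has probability 1 / `S.card`, so they exhaust the space; this
excludes ties without a separate argument. -/
lemma ae_exists_firstAlone (hm : ∀ p, Measurable (η p))
    (hlaw : ∀ p, μ.map (η p) = expMeasure 1) (hind : iIndepFun η μ) {S : Finset ι}
    (hS : S.Nonempty) :
    ∀ᵐ ω ∂μ, ∃ p ∈ S, ω ∈ firstAlone η S p := by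
  have hc : (0 : ℝ) < S.card := by exact_mod_cast hS.card_pos
  have h1 : ∀ p ∈ S, μ (firstAlone η S p) = ENNReal.ofReal (1 / S.card) := by
    intro p hp
    have := lintegral_indicator_firstAlone hm hlaw hind S hp (φ := fun _ => 1) measurable_const
    rw [lintegral_indicator (measurableSet_firstAlone hm S p)] at this
    simp only [lintegral_const, one_mul, MeasurableSet.univ, Measure.restrict_apply,
      Set.univ_inter, lintegral_exp_neg_mul_Ioi hc] at this
    simpa using this
  have hd : Set.PairwiseDisjoint (S : Set ι) (firstAlone η S) := by
    intro p hp q hq hpq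
    refine Set.disjoint_left.2 fun ω h h' => ?_
    exact lt_asymm (h q hq hpq.symm) (h' p hp hpq)
  have h2 : μ (⋃ p ∈ S, firstAlone η S p) = 1 := by
    rw [measure_biUnion_finset hd fun p _ => measurableSet_firstAlone hm S p,
      Finset.sum_congr rfl h1, Finset.sum_const, nsmul_eq_mul, ← ENNReal.ofReal_natCast,
      ← ENNReal.ofReal_mul hc.le, mul_one_div_cancel hc.ne', ENNReal.ofReal_one]
  have h3 := (prob_compl_eq_zero_iff
    (Finset.measurableSet_biUnion S fun p _ => measurableSet_firstAlone hm S p)).2 h2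
  rw [ae_iff]
  convert h3 using 2
  ext; simp

end Race

/-! ### The first ring in an urn -/

lemma finite_balls (x : Urn) : (balls x).Finite := by
  refine (Set.finite_iUnion fun c : Fin 2 =>
    (Set.finite_lt_nat (x c).toNat).image fun k => (c, k)).subset ?_
  rintro ⟨c, k⟩ h
  simp only [balls, Set.mem_ofPred_eq] at h
  simp only [Set.mem_iUnion, Set.mem_image, Set.mem_ofPred_eq]
  exact ⟨c, k, by omega, rfl⟩

/-- The balls in an urn as a finite set. -/
noncomputable def ballFinset (x : Urn) : Finset Ball := (finite_balls x).toFinset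

@[simp] lemma mem_ballFinset {x : Urn} {p : Ball} : p ∈ ballFinset x ↔ (p.2 : ℤ) < x p.1 := by
  simp [ballFinset, balls]

lemma sum_ballFinset (x : Urn) {A : Type*} [AddCommMonoid A] (g : Fin 2 → A) :
    ∑ p ∈ ballFinset x, g p.1 = ∑ c, (x c).toNat • g c := by
  classical
  have h : ballFinset x = Finset.univ.biUnion fun c : Fin 2 =>
      (Finset.range (x c).toNat).image fun k => (c, k) := by
    ext ⟨c, k⟩
    simp
  rw [h, Finset.sum_biUnion]
  · refine Finset.sum_congr rfl fun c _ => ?_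
    rw [Finset.sum_image (by simp)]
    simp
  · intro c _ d _ hcd
    simp only [Function.onFun, Finset.disjoint_left, Finset.mem_image]
    rintro _ ⟨k, _, rfl⟩ ⟨l, _, h⟩
    exact hcd (congrArg Prod.fst h).symm

lemma card_ballFinset (x : Urn) : (ballFinset x).card = (x 0).toNat + (x 1).toNat := by
  have := sum_ballFinset x (fun _ => 1)
  simpa using this

lemma waitingTime_eq_of_mem {x : Urn} {r : Ball → ℝ} {p : Ball} (hp : p ∈ balls x)
    (h : ∀ q ∈ balls x, r p ≤ r q) : waitingTime x r = r p :=
  IsLeast.csInf_eq ⟨⟨p, hp, rfl⟩, by rintro _ ⟨q, hq, rfl⟩; exact h q hq⟩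

lemma drawnColour_eq_of_alone {x : Urn} {r : Ball → ℝ} {p : Ball} (hp : p ∈ balls x)
    (h : ∀ q ∈ balls x, q ≠ p → r p < r q) : drawnColour x r = p.1 := by
  have hw : waitingTime x r = r p := waitingTime_eq_of_mem hp fun q hq => by
    by_cases hqp : q = p
    · rw [hqp]
    · exact (h q hq hqp).le
  have key : ∀ q ∈ balls x, r q = waitingTime x r → q = p := fun q hq e => by
    by_contra hqp
    exact absurd (h q hq hqp) (by rw [e, hw]; exact lt_irrefl _)
  unfold drawnColour
  split_ifs with hc
  · obtain ⟨q, hq, h0, e⟩ := hc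
    rw [← key q hq e, h0]
  · have : p.1 ≠ 0 := fun h0 => hc ⟨p, hp, h0, hw.symm⟩
    omega

/-- The infimum over a finite nonempty set is attained, so the drawn colour is present for every
`r`, ties included. Reachability of the contents thus holds surely and not just almost surely. -/
lemma drawnColour_pos {x : Urn} (hx : 0 < x 0 + x 1) (r : Ball → ℝ) :
    0 < x (drawnColour x r) := by
  have hne : (balls x).Nonempty := by
    by_cases h : 0 < x 0
    · exact ⟨(0, 0), by simpa [balls] using h⟩
    · exact ⟨(1, 0), by simp [balls]; omega⟩
  obtain ⟨p, hp, e⟩ := (hne.image r).csInf_mem ((finite_balls x).image r)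
  unfold drawnColour
  split_ifs with hc
  · obtain ⟨q, hq, h0, -⟩ := hc
    have : (q.2 : ℤ) < x q.1 := hq
    rw [h0] at this
    omega
  · have h1 : p.1 ≠ 0 := fun h0 => hc ⟨p, hp, h0, e⟩
    have h1 : p.1 = 1 := by omega
    have : (p.2 : ℤ) < x p.1 := hp
    rw [h1] at this
    omega

lemma waitingTime_nonneg (x : Urn) {r : Ball → ℝ} (hr : ∀ p, 0 ≤ r p) : 0 ≤ waitingTime x r :=
  Real.sInf_nonneg (by rintro _ ⟨p, _, rfl⟩; exact hr p)

lemma measurable_waitingTime (x : Urn) : Measurable (waitingTime x) :=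
  Measurable.sInf (f := fun (p : Ball) (r : Ball → ℝ) => r p) (finite_balls x).countable
    fun p _ => measurable_pi_apply p

lemma measurable_drawnColour (x : Urn) : Measurable (drawnColour x) := by
  classical
  unfold drawnColour
  refine Measurable.ite ?_ measurable_const measurable_const
  have : {r : Ball → ℝ | ∃ p ∈ balls x, p.1 = 0 ∧ r p = waitingTime x r}
      = ⋃ p ∈ balls x, {r | p.1 = 0 ∧ r p = waitingTime x r} := by
    ext; simp
  rw [this]
  exact MeasurableSet.biUnion (finite_balls x).countable fun p _ =>
    (MeasurableSet.const _).inter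
      (measurableSet_eq_fun (measurable_pi_apply p) (measurable_waitingTime x))

/-- The joint law of the time of the next epoch and the colour drawn there. -/
lemma lintegral_waitingTime_drawnColour {Ω : Type*} [MeasurableSpace Ω] {μ : Measure Ω}
    [IsProbabilityMeasure μ] {η : Ball → Ω → ℝ} (hm : ∀ p, Measurable (η p))
    (hlaw : ∀ p, μ.map (η p) = expMeasure 1) (hind : iIndepFun η μ) {x : Urn}
    (hx : 0 < x 0 + x 1) (hx0 : ∀ c, 0 ≤ x c) {φ : ℝ → Fin 2 → ℝ≥0∞}
    (hφ : ∀ c, Measurable fun r => φ r c) :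
    ∫⁻ ω, φ (waitingTime x fun p => η p ω) (drawnColour x fun p => η p ω) ∂μ
      = ∑ c, ENNReal.ofReal (x c) * ∫⁻ r in Set.Ioi 0,
          φ r c * ENNReal.ofReal (Real.exp (-((x 0 + x 1 : ℤ) * r))) := by
  have hcard := card_ballFinset x
  have h00 := hx0 0
  have h01 := hx0 1
  have hS : (ballFinset x).Nonempty := by
    rw [← Finset.card_pos]
    omega
  -- Almost surely exactly one ball rings first, and only its summand survives.
  have hae : ∀ᵐ ω ∂μ, φ (waitingTime x fun p => η p ω) (drawnColour x fun p => η p ω)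
      = ∑ p ∈ ballFinset x,
        (firstAlone η (ballFinset x) p).indicator (fun ω => φ (η p ω) p.1) ω := by
    filter_upwards [ae_exists_firstAlone hm hlaw hind hS] with ω ⟨p, hp, hω⟩
    have hpb : p ∈ balls x := by simpa [balls] using hp
    have hω' : ∀ q ∈ balls x, q ≠ p → η p ω < η q ω := fun q hq => hω q (mem_ballFinset.2 hq)
    rw [drawnColour_eq_of_alone (r := fun p => η p ω) hpb hω',
      waitingTime_eq_of_mem (r := fun p => η p ω) hpb fun q hq => by
        by_cases hqp : q = p
        · rw [hqp]
        · exact (hω' q hq hqp).le,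
      Finset.sum_eq_single_of_mem p hp, Set.indicator_of_mem hω]
    intro q hq hqp
    exact Set.indicator_of_notMem (fun h : ω ∈ firstAlone η _ q =>
      lt_asymm (hω q hq hqp) (h p hp hqp.symm)) _
  rw [lintegral_congr_ae hae, lintegral_finsetSum]
  · rw [Finset.sum_congr rfl fun p hp =>
      lintegral_indicator_firstAlone hm hlaw hind (ballFinset x) hp (hφ p.1),
      sum_ballFinset x fun c => ∫⁻ r in Set.Ioi 0,
        φ r c * ENNReal.ofReal (Real.exp (-((ballFinset x).card * r)))]
    refine Finset.sum_congr rfl fun c _ => ?_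
    have e1 : (((x 0 + x 1 : ℤ)) : ℝ) = (ballFinset x).card := by
      rw [hcard]
      exact_mod_cast (by omega : x 0 + x 1 = (((x 0).toNat + (x 1).toNat : ℕ) : ℤ))
    have e2 : ((x c : ℤ) : ℝ) = ((x c).toNat : ℝ) := by
      exact_mod_cast (Int.toNat_of_nonneg (hx0 c)).symm
    rw [e1, e2, nsmul_eq_mul, ENNReal.ofReal_natCast]
  · exact fun p _ => ((hφ p.1).comp (hm p)).indicator (measurableSet_firstAlone hm _ p)

/-! ### The epochs -/

section Epochs

variable {Ω : Type*} [MeasurableSpace Ω] {μ : Measure Ω} {M : Matrix (Fin 2) (Fin 2) ℤ} {x₀ : Urn}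
  {ξ : ℕ → Ball → Ω → ℝ}

lemma reachable_epoch (hten : Tenable M x₀) (r : ℕ → Ball → ℝ) (n : ℕ) :
    Reachable M x₀ (epoch M x₀ r n).2 := by
  induction n with
  | zero => exact .start
  | succ n ih => exact ih.draw _ (drawnColour_pos (hten _ ih).2 _)

/-- `Urn` is countable, so joint measurability reduces to that for each fixed urn. -/
lemma measurable_waitingTime_uncurry :
    Measurable fun z : Urn × (Ball → ℝ) => waitingTime z.1 z.2 :=
  measurable_from_prod_countable_right measurable_waitingTime

lemma measurable_drawnColour_uncurry :
    Measurable fun z : Urn × (Ball → ℝ) => drawnColour z.1 z.2 :=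
  measurable_from_prod_countable_right measurable_drawnColour

lemma measurable_epoch (hm : ∀ n p, Measurable (ξ n p)) (n : ℕ) :
    Measurable fun ω => epoch M x₀ (fun m p => ξ m p ω) n := by
  induction n with
  | zero => exact measurable_const
  | succ n ih =>
    have hp : Measurable fun ω => ((epoch M x₀ (fun m p => ξ m p ω) n).2, fun p => ξ n p ω) :=
      ih.snd.prodMk (measurable_pi_lambda _ fun p => hm n p)
    have h1 : Measurable fun q : Urn × Fin 2 => q.1 + M q.2 := measurable_of_countable _
    have h2 := ih.fst.add (measurable_waitingTime_uncurry.comp hp)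
    have h3 := h1.comp (ih.snd.prodMk (measurable_drawnColour_uncurry.comp hp))
    exact h2.prodMk h3

/-- The expectation of a function of the `n`-th epoch and
of the time and the colour of the draw that follows it. -/
lemma IsClockSystem.lintegral_step [IsProbabilityMeasure μ] (hξ : IsClockSystem μ M x₀ ξ)
    (hten : Tenable M x₀) (n : ℕ) {F : ℝ × Urn → ℝ → Fin 2 → ℝ≥0∞}
    (hF : ∀ c, Measurable fun q : (ℝ × Urn) × ℝ => F q.1 q.2 c) {Z : Ω → ℝ × Urn}
    (hZ : Z = fun ω => epoch M x₀ (fun m p => ξ m p ω) n) :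
    ∫⁻ ω, F (Z ω) (waitingTime (Z ω).2 fun p => ξ n p ω)
        (drawnColour (Z ω).2 fun p => ξ n p ω) ∂μ
      = ∫⁻ ω, ∑ c, ENNReal.ofReal ((Z ω).2 c) * (∫⁻ r in Set.Ioi (0 : ℝ), F (Z ω) r c *
          ENNReal.ofReal (Real.exp (-(((Z ω).2 0 + (Z ω).2 1 : ℤ) * r)))) ∂μ := by
  have hZm : Measurable Z := by rw [hZ]; exact measurable_epoch hξ.measurable n
  have hY : Measurable fun ω p => ξ n p ω := measurable_pi_lambda _ fun p => hξ.measurable n p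
  have hI : IndepFun Z (fun ω p => ξ n p ω) μ := by
    have hl : Measurable fun z : Fin (n + 1) → ℝ × Urn => z (Fin.last n) := measurable_pi_apply _
    have := (hξ.indep_past n).comp hl measurable_id
    rw [hZ]
    exact this
  have hF' : Measurable fun q : ((ℝ × Urn) × ℝ) × Fin 2 => F q.1.1 q.1.2 q.2 :=
    measurable_from_prod_countable_left hF
  have hz : Measurable fun q : (ℝ × Urn) × (Ball → ℝ) => (q.1.2, q.2) :=
    measurable_fst.snd.prodMk measurable_snd
  have hG : Measurable fun q : (ℝ × Urn) × (Ball → ℝ) =>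
      F q.1 (waitingTime q.1.2 q.2) (drawnColour q.1.2 q.2) :=
    hF'.comp ((measurable_fst.prodMk (measurable_waitingTime_uncurry.comp hz)).prodMk
      (measurable_drawnColour_uncurry.comp hz))
  have := lintegral_of_indepFun hZm hY hI hG
  refine this.trans (lintegral_congr fun ω => ?_)
  have hr : Reachable M x₀ (Z ω).2 := by rw [hZ]; exact reachable_epoch hten _ n
  exact lintegral_waitingTime_drawnColour (hξ.measurable n) (hξ.law n) (hξ.indep n)
    (hten _ hr).2 (hten _ hr).1 fun c => (hF c).comp measurable_prodMk_left

lemma IsClockSystem.ae_nonneg (hξ : IsClockSystem μ M x₀ ξ) : ∀ᵐ ω ∂μ, ∀ n p, 0 ≤ ξ n p ω := by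
  rw [ae_all_iff]
  intro n
  rw [ae_all_iff]
  intro p
  have h : ∀ᵐ r ∂(expMeasure 1), (0 : ℝ) ≤ r := by
    have := lintegral_expMeasure_one (φ := (Set.Iio 0).indicator 1)
      (measurable_one.indicator measurableSet_Iio)
    rw [lintegral_indicator_one measurableSet_Iio, setLIntegral_congr_fun (g := fun _ => 0)
      measurableSet_Ioi, lintegral_zero] at this
    · rw [ae_iff]
      simpa [Set.Iio] using this
    · intro r hr
      simp [not_lt.2 (le_of_lt hr : (0 : ℝ) ≤ r)]
  rw [← hξ.law n p] at h
  exact ae_of_ae_map (hξ.measurable n p).aemeasurable h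

lemma monotone_epoch {r : ℕ → Ball → ℝ} (hr : ∀ n p, 0 ≤ r n p) :
    Monotone fun n => (epoch M x₀ r n).1 :=
  monotone_nat_of_le_succ fun n => by
    have := waitingTime_nonneg (epoch M x₀ r n).2 (hr n)
    simpa [epoch] using this

/-- Nonnegative clocks make the epoch times monotone, so the set under `sSup` is an initial segment
with greatest element `n`. -/
lemma epochCount_eq {r : ℕ → Ball → ℝ} (hr : ∀ n p, 0 ≤ r n p) {t : ℝ} {n : ℕ}
    (h1 : (epoch M x₀ r n).1 ≤ t) (h2 : t < (epoch M x₀ r (n + 1)).1) :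
    epochCount M x₀ r t = n := by
  refine IsGreatest.csSup_eq ⟨h1, fun k hk => ?_⟩
  by_contra hkn
  exact absurd (h2.trans_le (monotone_epoch hr (by omega : n + 1 ≤ k))) (not_lt.2 hk)

lemma exists_epoch_le_lt {r : ℕ → Ball → ℝ} {t : ℝ} (ht : 0 ≤ t)
    (h : ∃ n, t < (epoch M x₀ r n).1) :
    ∃ n, (epoch M x₀ r n).1 ≤ t ∧ t < (epoch M x₀ r (n + 1)).1 := by
  classical
  have h0 : Nat.find h ≠ 0 := fun h0 => by
    have := Nat.find_spec h
    rw [h0] at this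
    exact absurd ht (not_le.2 this)
  obtain ⟨n, hn⟩ := Nat.exists_eq_succ_of_ne_zero h0
  refine ⟨n, not_lt.1 (Nat.find_min h (by omega)), ?_⟩
  have := Nat.find_spec h
  rwa [hn] at this

/-- If the process does not explode, the expectation at a fixed time is the sum over the numbers
of epochs. -/
lemma IsClockSystem.lintegral_urnAt (hξ : IsClockSystem μ M x₀ ξ) {t : ℝ} (ht : 0 ≤ t)
    (hexp : ∀ᵐ ω ∂μ, ∃ n, t < (epoch M x₀ (fun m p => ξ m p ω) n).1) (f : Urn → ℝ≥0∞) :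
    ∫⁻ ω, f (urnAt M x₀ (fun m p => ξ m p ω) t) ∂μ
      = ∑' n, ∫⁻ ω, if (epoch M x₀ (fun m p => ξ m p ω) n).1 ≤ t ∧
          t < (epoch M x₀ (fun m p => ξ m p ω) (n + 1)).1
        then f (epoch M x₀ (fun m p => ξ m p ω) n).2 else 0 ∂μ := by
  have hf : Measurable f := measurable_of_countable f
  rw [← lintegral_tsum]
  · refine lintegral_congr_ae ?_
    filter_upwards [hexp, hξ.ae_nonneg] with ω hω hpos
    obtain ⟨n, h1, h2⟩ := exists_epoch_le_lt ht hω
    rw [tsum_eq_single n, if_pos ⟨h1, h2⟩, urnAt, epochCount_eq hpos h1 h2]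
    intro k hk
    refine if_neg fun hc => hk ?_
    rw [← epochCount_eq hpos hc.1 hc.2, epochCount_eq hpos h1 h2]
  · intro n
    refine (Measurable.ite ?_ (hf.comp (measurable_epoch hξ.measurable n).snd)
      measurable_const).aemeasurable
    exact (measurableSet_le (measurable_epoch hξ.measurable n).fst measurable_const).inter
      (measurableSet_lt measurable_const (measurable_epoch hξ.measurable (n + 1)).fst)

/-- Off a null set, the contents at time `t` are the limit of measurable partial sums over the
epochs with at most one nonzero term. On an exploding path `sSup` could take its default value,
hence `hexp`. -/
lemma IsClockSystem.aemeasurable_urnAt (hξ : IsClockSystem μ M x₀ ξ) {t : ℝ} (ht : 0 ≤ t)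
    (hexp : ∀ᵐ ω ∂μ, ∃ n, t < (epoch M x₀ (fun m p => ξ m p ω) n).1) :
    AEMeasurable (fun ω => urnAt M x₀ (fun m p => ξ m p ω) t) μ := by
  have hlim : ∀ᵐ ω ∂μ, Filter.Tendsto (fun n : ℕ => ∑ k ∈ Finset.range n,
      if (epoch M x₀ (fun m p => ξ m p ω) k).1 ≤ t ∧
          t < (epoch M x₀ (fun m p => ξ m p ω) (k + 1)).1
        then (epoch M x₀ (fun m p => ξ m p ω) k).2 else 0) Filter.atTop
      (nhds (urnAt M x₀ (fun m p => ξ m p ω) t)) := by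
    filter_upwards [hexp, hξ.ae_nonneg] with ω hω hpos
    obtain ⟨n, h1, h2⟩ := exists_epoch_le_lt ht hω
    refine HasSum.tendsto_sum_nat ?_
    rw [urnAt, epochCount_eq hpos h1 h2]
    convert hasSum_single n ?_
    · rw [if_pos ⟨h1, h2⟩]
    intro k hk
    refine if_neg fun hc => hk ?_
    rw [← epochCount_eq hpos hc.1 hc.2, epochCount_eq hpos h1 h2]
  refine aemeasurable_of_tendsto_metrizable_ae Filter.atTop (fun n => ?_) hlim
  refine (Finset.measurable_fun_sum _ fun k _ => Measurable.ite ?_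
    (measurable_epoch hξ.measurable k).snd measurable_const).aemeasurable
  exact (measurableSet_le (measurable_epoch hξ.measurable k).fst measurable_const).inter
    (measurableSet_lt measurable_const (measurable_epoch hξ.measurable (k + 1)).fst)

end Epochs

/-! ### Test functions -/

/-- Here `v` is the time left: a ring at `r ≤ v` pays `g r`, while a later ring pays the frozen
value `b`. -/
lemma lintegral_Ioi_stopped {g : ℝ → ℝ} (hg : Continuous g) {v : ℝ} (hv : 0 ≤ v)
    (hpos : ∀ r, 0 ≤ r → r ≤ v → 0 ≤ g r) {b l : ℝ} (hb : 0 ≤ b) (hl : 0 < l) :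
    ∫⁻ r in Set.Ioi (0 : ℝ), (if r ≤ v then ENNReal.ofReal (g r) else ENNReal.ofReal b) *
        ENNReal.ofReal (Real.exp (-(l * r)))
      = ENNReal.ofReal ((∫ r in 0..v, g r * Real.exp (-(l * r))) + b * Real.exp (-(l * v)) / l) := by
  have hc : Continuous fun r => g r * Real.exp (-(l * r)) := by fun_prop
  have h0 : 0 ≤ ∫ r in 0..v, g r * Real.exp (-(l * r)) :=
    intervalIntegral.integral_nonneg hv fun r hr =>
      mul_nonneg (hpos r hr.1 hr.2) (Real.exp_pos _).le
  rw [← Set.Ioc_union_Ioi_eq_Ioi hv,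
    lintegral_union measurableSet_Ioi (Set.Ioc_disjoint_Ioi le_rfl),
    setLIntegral_congr_fun (g := fun r => ENNReal.ofReal (g r * Real.exp (-(l * r))))
      measurableSet_Ioc fun r hr => by
        simp only [if_pos hr.2]
        rw [ENNReal.ofReal_mul (hpos r hr.1.le hr.2)],
    setLIntegral_congr_fun (g := fun r => ENNReal.ofReal b * ENNReal.ofReal (Real.exp (-(l * r))))
      measurableSet_Ioi fun r hr => by simp only [if_neg (not_le.2 (Set.mem_Ioi.1 hr))],
    lintegral_const_mul _ (by fun_prop), lintegral_exp_neg_mul_Ioi hl,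
    ← ENNReal.ofReal_mul hb, ENNReal.ofReal_add h0 (by positivity),
    intervalIntegral.integral_of_le hv, mul_div_assoc,
    ← ofReal_integral_eq_lintegral_ofReal]
  · exact hc.integrableOn_Ioc
  · exact (ae_restrict_iff' measurableSet_Ioc).2 (.of_forall fun r hr =>
      mul_nonneg (hpos r hr.1.le hr.2) (Real.exp_pos _).le)

/-- A nonnegative solution of the backward equation of the chain that jumps from `x` to `x + a`
with rate `x + Δ` and to `x - a` with rate `x`. -/
structure IsBackwardSolution (a Δ : ℝ) (h : ℝ → ℝ → ℝ) : Prop where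
  continuous : Continuous (Function.uncurry h)
  nonneg : ∀ v x, 0 ≤ v → 0 ≤ x → 0 ≤ h v x
  hasDerivAt : ∀ v x, HasDerivAt (fun v => h v x)
    ((x + Δ) * (h v (x + a) - h v x) + x * (h v (x - a) - h v x)) v

/-- Variation of constants: the backward equation cancels the terms in `h (v - r) x` when `h (v - r)
x * exp (-((2 * x + Δ) * r))` is differentiated in `r`, leaving only the two neighbours of `x`. -/
lemma IsBackwardSolution.integral_eq {a Δ : ℝ} {h : ℝ → ℝ → ℝ} (hh : IsBackwardSolution a Δ h)
    (x v : ℝ) :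
    x * (∫ r in 0..v, h (v - r) (x - a) * Real.exp (-((2 * x + Δ) * r)))
      + (x + Δ) * (∫ r in 0..v, h (v - r) (x + a) * Real.exp (-((2 * x + Δ) * r)))
      + h 0 x * Real.exp (-((2 * x + Δ) * v)) = h v x := by
  have hc : ∀ y, Continuous fun r => h (v - r) y * Real.exp (-((2 * x + Δ) * r)) := fun y =>
    (hh.continuous.comp (f := fun r => (v - r, y)) (by fun_prop)).mul (by fun_prop)
  have hd : ∀ r ∈ Set.uIcc 0 v, HasDerivAt
      (fun r => -(h (v - r) x * Real.exp (-((2 * x + Δ) * r))))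
      (x * (h (v - r) (x - a) * Real.exp (-((2 * x + Δ) * r)))
        + (x + Δ) * (h (v - r) (x + a) * Real.exp (-((2 * x + Δ) * r)))) r := by
    intro r _
    have h1 := (hh.hasDerivAt (v - r) x).comp r ((hasDerivAt_id r).const_sub v)
    have h2 : HasDerivAt (fun r => Real.exp (-((2 * x + Δ) * r)))
        (Real.exp (-((2 * x + Δ) * r)) * -((2 * x + Δ) * 1)) r :=
      (((hasDerivAt_id r).const_mul (2 * x + Δ)).neg).exp
    have h3 := (h1.mul h2).neg
    refine h3.congr_deriv ?_
    simp only [Function.comp]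
    ring
  have hi := intervalIntegral.integral_eq_sub_of_hasDerivAt hd
    ((((hc _).const_mul x).add ((hc _).const_mul (x + Δ))).intervalIntegrable _ _)
  rw [intervalIntegral.integral_add (((hc _).const_mul x).intervalIntegrable _ _)
      (((hc _).const_mul _).intervalIntegrable _ _), intervalIntegral.integral_const_mul,
    intervalIntegral.integral_const_mul] at hi
  rw [hi]
  simp

lemma IsBackwardSolution.lintegral_eq {a Δ : ℝ} (ha : 0 ≤ a) {h : ℝ → ℝ → ℝ}
    (hh : IsBackwardSolution a Δ h) {x v : ℝ} (hx : x = 0 ∨ a ≤ x) (hΔ : 0 < Δ) (hv : 0 ≤ v) :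
    ENNReal.ofReal x * (∫⁻ r in Set.Ioi (0 : ℝ),
        (if r ≤ v then ENNReal.ofReal (h (v - r) (x - a)) else ENNReal.ofReal (h 0 x)) *
          ENNReal.ofReal (Real.exp (-((2 * x + Δ) * r))))
      + ENNReal.ofReal (x + Δ) * (∫⁻ r in Set.Ioi (0 : ℝ),
        (if r ≤ v then ENNReal.ofReal (h (v - r) (x + a)) else ENNReal.ofReal (h 0 x)) *
          ENNReal.ofReal (Real.exp (-((2 * x + Δ) * r))))
      = ENNReal.ofReal (h v x) := by
  have hx0 : 0 ≤ x := hx.elim (fun h => h.ge) ha.trans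
  have hl : 0 < 2 * x + Δ := by linarith
  have hb := hh.nonneg 0 x le_rfl hx0
  have hc : ∀ y, Continuous fun r => h (v - r) y := fun y =>
    hh.continuous.comp (f := fun r => (v - r, y)) (by fun_prop)
  have hp : ∀ y, 0 ≤ y → ∀ r, 0 ≤ r → r ≤ v → 0 ≤ h (v - r) y := fun y hy r _ hr =>
    hh.nonneg _ _ (by linarith) hy
  have hI : ∀ y, 0 ≤ y → 0 ≤ ∫ r in 0..v, h (v - r) y * Real.exp (-((2 * x + Δ) * r)) :=
    fun y hy => intervalIntegral.integral_nonneg hv fun r hr =>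
      mul_nonneg (hp y hy r hr.1 hr.2) (Real.exp_pos _).le
  have hE : 0 ≤ h 0 x * Real.exp (-((2 * x + Δ) * v)) / (2 * x + Δ) := by positivity
  rw [lintegral_Ioi_stopped (hc _) hv (hp (x + a) (by linarith)) hb hl,
    ← ENNReal.ofReal_mul (by linarith)]
  have key := hh.integral_eq x v
  -- The no-jump term is shared between the two colours in proportion to their rates, which add up
  -- to `2 * x + Δ`.
  have hsum : h 0 x * Real.exp (-((2 * x + Δ) * v)) = (2 * x + Δ) *
      (h 0 x * Real.exp (-((2 * x + Δ) * v)) / (2 * x + Δ)) := by field_simp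
  rw [hsum] at key
  -- At `x = 0` the lower neighbour `-a` may lie where `h` is not known to be nonnegative, but its
  -- rate is zero.
  rcases hx with rfl | hax
  · rw [ENNReal.ofReal_zero, zero_mul, zero_add, ← key]
    congr 1
    ring
  · rw [lintegral_Ioi_stopped (hc _) hv (hp (x - a) (by linarith)) hb hl,
      ← ENNReal.ofReal_mul hx0, ← ENNReal.ofReal_add, ← key]
    · congr 1
      ring
    · exact mul_nonneg hx0 (add_nonneg (hI _ (by linarith)) hE)
    · exact mul_nonneg (by linarith) (add_nonneg (hI _ (by linarith)) hE)

lemma isBackwardSolution_mean {a Δ : ℝ} (ha : 0 ≤ a) (hΔ : 0 ≤ Δ) :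
    IsBackwardSolution a Δ fun v x => x + a * Δ * v where
  continuous := by unfold Function.uncurry; fun_prop
  nonneg v x hv hx := by positivity
  hasDerivAt v x := by
    refine (((hasDerivAt_id v).const_mul (a * Δ)).const_add x).congr_deriv ?_
    ring

/-- The square of the mean plus the claimed variance; at `v = 0` it is `x ^ 2`. -/
lemma isBackwardSolution_secondMoment {a Δ : ℝ} (ha : 0 ≤ a) (hΔ : 0 ≤ Δ) :
    IsBackwardSolution a Δ fun v x =>
      (x + a * Δ * v) ^ 2 + a ^ 2 * v * (2 * x + Δ + a * Δ * v) where
  continuous := by unfold Function.uncurry; fun_prop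
  nonneg v x hv hx := by positivity
  hasDerivAt v x := by
    have h1 := (((hasDerivAt_id v).const_mul (a * Δ)).const_add x).pow 2
    have h2 := ((hasDerivAt_id v).const_mul (a ^ 2)).mul
      (((hasDerivAt_id v).const_mul (a * Δ)).const_add (2 * x + Δ))
    refine (h1.add h2).congr_deriv ?_
    simp
    ring

/-- With `y = n + 1 + x`, both jumps are bounded by the upward one. It remains that total rate times
growth of the cube is at most `c * y ^ 3`: the rate is O(y) and the growth O(y^2). -/
lemma supermartingale_step {a Δ c x y : ℝ} (ha : 0 ≤ a) (hx : x = 0 ∨ a ≤ x) (hΔ : 0 < Δ)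
    (hc : c = 7 * (2 + Δ) * (1 + a) ^ 3) (hy : 1 ≤ y) (hxy : x ≤ y) :
    ENNReal.ofReal x * (∫⁻ r in Set.Ioi (0 : ℝ),
        ENNReal.ofReal ((y + 1 - a) ^ 3 * Real.exp (-(c * r))) *
          ENNReal.ofReal (Real.exp (-((2 * x + Δ) * r))))
      + ENNReal.ofReal (x + Δ) * (∫⁻ r in Set.Ioi (0 : ℝ),
        ENNReal.ofReal ((y + 1 + a) ^ 3 * Real.exp (-(c * r))) *
          ENNReal.ofReal (Real.exp (-((2 * x + Δ) * r))))
      ≤ ENNReal.ofReal (y ^ 3) := by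
  have hx0 : 0 ≤ x := hx.elim (fun h => h.ge) ha.trans
  have hc0 : 0 < c := by rw [hc]; positivity
  have hl : 0 < 2 * x + Δ + c := by linarith
  have key : ∀ z : ℝ, z ≤ y + 1 + a → ∫⁻ r in Set.Ioi (0 : ℝ),
      ENNReal.ofReal (z ^ 3 * Real.exp (-(c * r))) *
        ENNReal.ofReal (Real.exp (-((2 * x + Δ) * r)))
      ≤ ENNReal.ofReal ((y + 1 + a) ^ 3 / (2 * x + Δ + c)) := by
    intro z hz
    -- `z = y + 1 - a` may be negative, so monotonicity of odd powers is needed.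
    have hz3 : z ^ 3 ≤ (y + 1 + a) ^ 3 := (Odd.strictMono_pow (by decide)).monotone hz
    calc _ ≤ ∫⁻ r in Set.Ioi (0 : ℝ), ENNReal.ofReal ((y + 1 + a) ^ 3) *
          ENNReal.ofReal (Real.exp (-((2 * x + Δ + c) * r))) := by
          refine lintegral_mono fun r => ?_
          rw [← ENNReal.ofReal_mul' (Real.exp_pos _).le, ← ENNReal.ofReal_mul' (Real.exp_pos _).le,
            mul_assoc, ← Real.exp_add]
          refine ENNReal.ofReal_le_ofReal ?_
          rw [show -(c * r) + -((2 * x + Δ) * r) = -((2 * x + Δ + c) * r) by ring]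
          gcongr
      _ = _ := by
          rw [lintegral_const_mul _ (by fun_prop), lintegral_exp_neg_mul_Ioi hl,
            ← ENNReal.ofReal_mul (by positivity)]
          simp [div_eq_mul_inv]
  refine (add_le_add (mul_le_mul_right (key _ (by linarith)) _)
    (mul_le_mul_right (key _ le_rfl) _)).trans ?_
  rw [← ENNReal.ofReal_mul hx0, ← ENNReal.ofReal_mul (by linarith),
    ← ENNReal.ofReal_add (by positivity) (by positivity)]
  refine ENNReal.ofReal_le_ofReal ?_
  rw [← add_mul, ← mul_div_assoc, div_le_iff₀ hl]
  -- The 7 in `c` is 3 + 3 + 1, the sum of the lower binomial coefficients.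
  have h1 : (y + 1 + a) ^ 3 - y ^ 3 ≤ 7 * (1 + a) ^ 3 * y ^ 2 := by
    have e : (y + 1 + a) ^ 3 - y ^ 3
      = 3 * (1 + a) * y ^ 2 + 3 * (1 + a) ^ 2 * y + (1 + a) ^ 3 := by ring
    have hb : 1 ≤ 1 + a := by linarith
    have hb1 : (1 + a) ≤ (1 + a) ^ 3 := le_self_pow₀ hb (by norm_num)
    have hb2 : (1 + a) ^ 2 ≤ (1 + a) ^ 3 := pow_le_pow_right₀ hb (by norm_num)
    have hy1 : y ≤ y ^ 2 := le_self_pow₀ hy (by norm_num)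
    have hy2 : 1 ≤ y ^ 2 := one_le_pow₀ hy
    have i1 : (1 + a) * y ^ 2 ≤ (1 + a) ^ 3 * y ^ 2 := by gcongr
    have i2 : (1 + a) ^ 2 * y ≤ (1 + a) ^ 3 * y ^ 2 := by gcongr
    have i3 : (1 + a) ^ 3 * 1 ≤ (1 + a) ^ 3 * y ^ 2 := by gcongr
    linarith
  have h2 : 2 * x + Δ ≤ (2 + Δ) * y := by nlinarith
  have h3 : (2 * x + Δ) * ((y + 1 + a) ^ 3 - y ^ 3) ≤ ((2 + Δ) * y) * (7 * (1 + a) ^ 3 * y ^ 2) :=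
    mul_le_mul h2 h1 (by
      have : y ^ 3 ≤ (y + 1 + a) ^ 3 := by gcongr; linarith
      linarith) (by positivity)
  rw [hc]
  linarith

/-! ### The constant-differentials urn -/

@[simp] lemma constDiffMatrix_zero_zero (a : ℕ) : constDiffMatrix a 0 0 = -(a : ℤ) := rfl
@[simp] lemma constDiffMatrix_zero_one (a : ℕ) : constDiffMatrix a 0 1 = -(a : ℤ) := rfl
@[simp] lemma constDiffMatrix_one_zero (a : ℕ) : constDiffMatrix a 1 0 = (a : ℤ) := rfl
@[simp] lemma constDiffMatrix_one_one (a : ℕ) : constDiffMatrix a 1 1 = (a : ℤ) := rfl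

lemma Reachable.sub_eq {a : ℕ} {x₀ x : Urn} (h : Reachable (constDiffMatrix a) x₀ x) :
    x 1 - x 0 = x₀ 1 - x₀ 0 := by
  induction h with
  | start => rfl
  | draw c _ _ ih => fin_cases c <;> simp [ih]

/-- A white ball that is present can be drawn, and this removes `a` white balls. -/
lemma Tenable.eq_zero_or_le {a : ℕ} {x₀ x : Urn} (hten : Tenable (constDiffMatrix a) x₀)
    (h : Reachable (constDiffMatrix a) x₀ x) : x 0 = 0 ∨ (a : ℤ) ≤ x 0 := by
  rcases ((hten x h).1 0).eq_or_lt' with h0 | h0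
  · exact .inl h0
  · refine .inr ?_
    have := (hten _ (h.draw 0 h0)).1 0
    simpa using this

section ConstDiff

variable {Ω : Type*} [MeasurableSpace Ω] {μ : Measure Ω} [IsProbabilityMeasure μ]
  {a : ℕ} {x₀ : Urn} {ξ : ℕ → Ball → Ω → ℝ} {Δ : ℤ}

lemma Tenable.cast_props (hten : Tenable (constDiffMatrix a) x₀) (hΔ : x₀ 1 - x₀ 0 = Δ) {x : Urn}
    (hx : Reachable (constDiffMatrix a) x₀ x) :
    ((x 0 : ℝ) = 0 ∨ (a : ℝ) ≤ x 0) ∧ (x 1 : ℝ) = x 0 + Δ ∧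
      ((x 0 + x 1 : ℤ) : ℝ) = 2 * x 0 + Δ := by
  have h1 : x 1 = x 0 + Δ := by
    have := hx.sub_eq
    omega
  refine ⟨?_, by exact_mod_cast h1, ?_⟩
  · exact_mod_cast hten.eq_zero_or_le hx
  · rw [h1]
    push_cast
    ring

lemma IsClockSystem.lintegral_discounted_cube_le
    (hξ : IsClockSystem μ (constDiffMatrix a) x₀ ξ) (hten : Tenable (constDiffMatrix a) x₀)
    (hΔ : x₀ 1 - x₀ 0 = Δ) (hΔ0 : 0 < Δ) {c : ℝ} (hc : c = 7 * (2 + Δ) * (1 + a) ^ 3) (n : ℕ) :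
    ∫⁻ ω, ENNReal.ofReal
        ((n + 1 + (epoch (constDiffMatrix a) x₀ (fun m p => ξ m p ω) n).2 0 : ℝ) ^ 3 *
          Real.exp (-(c * (epoch (constDiffMatrix a) x₀ (fun m p => ξ m p ω) n).1))) ∂μ
      ≤ ENNReal.ofReal ((1 + x₀ 0 : ℝ) ^ 3) := by
  induction n with
  | zero => simp [epoch]
  | succ n ih =>
    refine le_trans ?_ ih
    set Z : Ω → ℝ × Urn := fun ω => epoch (constDiffMatrix a) x₀ (fun m p => ξ m p ω) n with hZ
    -- The weight of epoch `n + 1` is grouped so that it becomes `y + 1 ± a` with `y = n + 1 + (Z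
    -- ω).2 0`.
    have hstep := hξ.lintegral_step hten n (F := fun z r k => ENNReal.ofReal
        ((n + 1 + (1 + (z.2 0 + constDiffMatrix a k 0 : ℤ)) : ℝ) ^ 3 *
          Real.exp (-(c * (z.1 + r))))) (fun k => by fun_prop) hZ
    calc _ = ∫⁻ ω, ENNReal.ofReal ((n + 1 + (1 + ((Z ω).2 0 +
            constDiffMatrix a (drawnColour (Z ω).2 fun p => ξ n p ω) 0 : ℤ)) : ℝ) ^ 3 *
            Real.exp (-(c * ((Z ω).1 + waitingTime (Z ω).2 fun p => ξ n p ω)))) ∂μ := by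
          refine lintegral_congr fun ω => ?_
          simp only [epoch, Pi.add_apply, Nat.cast_add, Nat.cast_one, hZ]
          congr 3
          ring
      _ ≤ _ := by
          rw [hstep]
          refine lintegral_mono fun ω => ?_
          have hr : Reachable (constDiffMatrix a) x₀ (Z ω).2 := reachable_epoch hten _ n
          obtain ⟨h1, h2, h3⟩ := Tenable.cast_props hten hΔ hr
          have hx0 : (0 : ℝ) ≤ (Z ω).2 0 := by exact_mod_cast (hten _ hr).1 0
          have hn : (0 : ℝ) ≤ n := n.cast_nonneg
          have key := supermartingale_step (y := n + 1 + (Z ω).2 0) (Nat.cast_nonneg a) h1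
            (by exact_mod_cast hΔ0) hc (by linarith) (by linarith)
          have hE : ∀ (u r : ℝ), ENNReal.ofReal (u ^ 3 * Real.exp (-(c * ((Z ω).1 + r))))
              = ENNReal.ofReal (Real.exp (-(c * (Z ω).1))) *
                ENNReal.ofReal (u ^ 3 * Real.exp (-(c * r))) := fun u r => by
            rw [← ENNReal.ofReal_mul (Real.exp_pos _).le, mul_add, neg_add, Real.exp_add]
            congr 1
            ring
          have hI : ∀ (u : ℝ), ∫⁻ r in Set.Ioi (0 : ℝ),
              ENNReal.ofReal (u ^ 3 * Real.exp (-(c * ((Z ω).1 + r)))) *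
                ENNReal.ofReal (Real.exp (-((2 * (Z ω).2 0 + Δ) * r)))
              = ENNReal.ofReal (Real.exp (-(c * (Z ω).1))) * ∫⁻ r in Set.Ioi (0 : ℝ),
                ENNReal.ofReal (u ^ 3 * Real.exp (-(c * r))) *
                  ENNReal.ofReal (Real.exp (-((2 * (Z ω).2 0 + Δ) * r))) := fun u => by
            rw [← lintegral_const_mul _ (by fun_prop)]
            refine lintegral_congr fun r => ?_
            rw [hE, mul_assoc]
          have e0 : (n + 1 + (1 + ((Z ω).2 0 + constDiffMatrix a 0 0 : ℤ)) : ℝ)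
              = n + 1 + (Z ω).2 0 + 1 - a := by
            rw [constDiffMatrix_zero_zero]
            push_cast
            ring
          have e1 : (n + 1 + (1 + ((Z ω).2 0 + constDiffMatrix a 1 0 : ℤ)) : ℝ)
              = n + 1 + (Z ω).2 0 + 1 + a := by
            rw [constDiffMatrix_one_zero]
            push_cast
            ring
          rw [Fin.sum_univ_two, h2, h3, hI, hI, e0, e1, mul_left_comm (ENNReal.ofReal ((Z ω).2 0)),
            mul_left_comm (ENNReal.ofReal ((Z ω).2 0 + Δ)), ← mul_add, mul_comm (_ ^ 3),
            ENNReal.ofReal_mul (Real.exp_pos _).le]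
          exact mul_le_mul_right key _

lemma IsClockSystem.lintegral_backward_step
    (hξ : IsClockSystem μ (constDiffMatrix a) x₀ ξ) (hten : Tenable (constDiffMatrix a) x₀)
    (hΔ : x₀ 1 - x₀ 0 = Δ) (hΔ0 : 0 < Δ) {h : ℝ → ℝ → ℝ} (hh : IsBackwardSolution a Δ h)
    (t : ℝ) (n : ℕ) {Z Z' : Ω → ℝ × Urn}
    (hZ : Z = fun ω => epoch (constDiffMatrix a) x₀ (fun m p => ξ m p ω) n)
    (hZ' : Z' = fun ω => epoch (constDiffMatrix a) x₀ (fun m p => ξ m p ω) (n + 1)) :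
    ∫⁻ ω, (if (Z ω).1 ≤ t then ENNReal.ofReal (h (t - (Z ω).1) ((Z ω).2 0)) else 0) ∂μ
      = ∫⁻ ω, (if (Z' ω).1 ≤ t then ENNReal.ofReal (h (t - (Z' ω).1) ((Z' ω).2 0)) else 0) ∂μ
        + ∫⁻ ω, (if (Z ω).1 ≤ t ∧ t < (Z' ω).1 then ENNReal.ofReal (h 0 ((Z ω).2 0)) else 0) ∂μ := by
  have hZm : Measurable Z := by rw [hZ]; exact measurable_epoch hξ.measurable n
  have hZm' : Measurable Z' := by rw [hZ']; exact measurable_epoch hξ.measurable (n + 1)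
  have hcast : Measurable fun x : Urn => (x 0 : ℝ) := measurable_of_countable _
  have hhm := hh.continuous.measurable
  have hstep := hξ.lintegral_step hten n (F := fun z r k =>
      if z.1 + r ≤ t then ENNReal.ofReal (h (t - (z.1 + r)) ((z.2 + constDiffMatrix a k) 0 : ℤ))
      else if z.1 ≤ t then ENNReal.ofReal (h 0 (z.2 0)) else 0) (fun k => by
        have hk : Measurable fun x : Urn => ((x + constDiffMatrix a k) 0 : ℝ) :=
          measurable_of_countable _
        refine Measurable.ite (measurableSet_le (by fun_prop) measurable_const) ?_
          (Measurable.ite (measurableSet_le (by fun_prop) measurable_const) ?_ measurable_const)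
        · exact (hhm.comp (f := fun q : (ℝ × Urn) × ℝ =>
            (t - (q.1.1 + q.2), ((q.1.2 + constDiffMatrix a k) 0 : ℝ)))
            ((by fun_prop : Measurable fun q : (ℝ × Urn) × ℝ => t - (q.1.1 + q.2)).prodMk
              (hk.comp measurable_fst.snd))).ennreal_ofReal
        · exact (hhm.comp (f := fun q : (ℝ × Urn) × ℝ => ((0 : ℝ), (q.1.2 0 : ℝ)))
            (measurable_const.prodMk (hcast.comp measurable_fst.snd))).ennreal_ofReal) hZ
  rw [← lintegral_add_left']
  · symm
    calc _ = ∫⁻ ω, (if (Z ω).1 + (waitingTime (Z ω).2 fun p => ξ n p ω) ≤ t then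
            ENNReal.ofReal (h (t - ((Z ω).1 + (waitingTime (Z ω).2 fun p => ξ n p ω)))
              (((Z ω).2 + constDiffMatrix a (drawnColour (Z ω).2 fun p => ξ n p ω)) 0 : ℤ))
            else if (Z ω).1 ≤ t then ENNReal.ofReal (h 0 ((Z ω).2 0)) else 0) ∂μ := by
          refine lintegral_congr fun ω => ?_
          have e : Z' ω = ((Z ω).1 + (waitingTime (Z ω).2 fun p => ξ n p ω),
            (Z ω).2 + constDiffMatrix a (drawnColour (Z ω).2 fun p => ξ n p ω)) := by
            rw [hZ', hZ]; rfl
          rw [e]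
          dsimp only
          by_cases h1 : (Z ω).1 + (waitingTime (Z ω).2 fun p => ξ n p ω) ≤ t
          · rw [if_pos h1, if_pos h1, if_neg (fun hc => absurd h1 (not_le.2 hc.2)), add_zero]
          · rw [if_neg h1, if_neg h1, zero_add]
            simp only [not_le.1 h1, and_true]
      _ = _ := by
          rw [hstep]
          refine lintegral_congr fun ω => ?_
          have hr : Reachable (constDiffMatrix a) x₀ (Z ω).2 := by
            rw [hZ]; exact reachable_epoch hten _ n
          obtain ⟨h1, h2, h3⟩ := Tenable.cast_props hten hΔ hr
          -- If epoch `n` is in time, this is the one-jump identity with time `t - (Z ω).1` left;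
          -- otherwise both sides vanish.
          by_cases hs : (Z ω).1 ≤ t
          · have key := hh.lintegral_eq (Nat.cast_nonneg a) h1 (by exact_mod_cast hΔ0)
              (sub_nonneg.2 hs)
            rw [if_pos hs, ← key, Fin.sum_univ_two, h2, h3]
            simp only [if_pos hs, Pi.add_apply, constDiffMatrix_zero_zero,
              constDiffMatrix_one_zero, Int.cast_add, Int.cast_sub, Int.cast_natCast,
              ← sub_eq_add_neg, le_sub_iff_add_le', sub_sub]
          · refine Eq.trans ?_ (if_neg hs).symm
            refine Finset.sum_eq_zero fun c _ => ?_
            rw [setLIntegral_congr_fun (g := fun _ => 0) measurableSet_Ioi, lintegral_zero,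
              mul_zero]
            intro r hr
            have hr' : 0 < r := hr
            simp only [if_neg hs, if_neg (show ¬ (Z ω).1 + r ≤ t by linarith), zero_mul]
  · refine (Measurable.ite (measurableSet_le hZm'.fst measurable_const) ?_
      measurable_const).aemeasurable
    exact (hhm.comp (f := fun ω => (t - (Z' ω).1, ((Z' ω).2 0 : ℝ)))
      ((measurable_const.sub hZm'.fst).prodMk (hcast.comp hZm'.snd))).ennreal_ofReal

/-- The process does not reach its `n`-th epoch early, not even with a quadratic weight. -/
lemma IsClockSystem.lintegral_sq_early_le
    (hξ : IsClockSystem μ (constDiffMatrix a) x₀ ξ) (hten : Tenable (constDiffMatrix a) x₀)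
    (hΔ : x₀ 1 - x₀ 0 = Δ) (hΔ0 : 0 < Δ) (t : ℝ) :
    ∃ K : ℝ, ∀ n : ℕ, ∫⁻ ω,
        (if (epoch (constDiffMatrix a) x₀ (fun m p => ξ m p ω) n).1 ≤ t then ENNReal.ofReal
          ((1 + (epoch (constDiffMatrix a) x₀ (fun m p => ξ m p ω) n).2 0 : ℝ) ^ 2) else 0) ∂μ
      ≤ ENNReal.ofReal (K / (n + 1)) := by
  set c : ℝ := 7 * (2 + Δ) * (1 + a) ^ 3 with hc
  have hΔr : (0 : ℝ) < Δ := by exact_mod_cast hΔ0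
  have hc0 : 0 ≤ c := by positivity
  refine ⟨Real.exp (c * t) * (1 + x₀ 0 : ℝ) ^ 3, fun n => ?_⟩
  have hn : (0 : ℝ) < n + 1 := by positivity
  have hb := hξ.lintegral_discounted_cube_le hten hΔ hΔ0 hc n
  calc _ ≤ ∫⁻ ω, ENNReal.ofReal (Real.exp (c * t) / (n + 1)) * ENNReal.ofReal
        ((n + 1 + (epoch (constDiffMatrix a) x₀ (fun m p => ξ m p ω) n).2 0 : ℝ) ^ 3 *
          Real.exp (-(c * (epoch (constDiffMatrix a) x₀ (fun m p => ξ m p ω) n).1))) ∂μ := by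
        refine lintegral_mono fun ω => ?_
        set Z := epoch (constDiffMatrix a) x₀ (fun m p => ξ m p ω) n with hZ
        dsimp only
        split_ifs with hs
        · have hx0 : (0 : ℝ) ≤ Z.2 0 := by
            exact_mod_cast (hten _ (reachable_epoch hten _ n)).1 0
          rw [← ENNReal.ofReal_mul (by positivity)]
          refine ENNReal.ofReal_le_ofReal ?_
          have e : Real.exp (c * t) / (n + 1) * ((n + 1 + Z.2 0 : ℝ) ^ 3 * Real.exp (-(c * Z.1)))
              = ((n + 1 + Z.2 0 : ℝ) ^ 3 / (n + 1)) * Real.exp (c * (t - Z.1)) := by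
            rw [mul_sub, sub_eq_add_neg, Real.exp_add]
            ring
          have h1 : 1 ≤ Real.exp (c * (t - Z.1)) :=
            Real.one_le_exp (mul_nonneg hc0 (sub_nonneg.2 hs))
          -- One factor of the cube is at least `n + 1`, the other two are at least `1 + Z.2 0`.
          have h2 : (1 + Z.2 0 : ℝ) ^ 2 ≤ (n + 1 + Z.2 0 : ℝ) ^ 3 / (n + 1) := by
            rw [le_div_iff₀ hn, pow_succ _ 2]
            have : (0 : ℝ) ≤ n := n.cast_nonneg
            exact mul_le_mul (pow_le_pow_left₀ (by linarith) (by linarith) 2) (by linarith) hn.le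
              (by positivity)
          rw [e]
          exact h2.trans (le_mul_of_one_le_right (by positivity) h1)
        · exact zero_le
    _ ≤ _ := by
        rw [lintegral_const_mul']
        · refine (mul_le_mul_right hb _).trans ?_
          rw [← ENNReal.ofReal_mul (by positivity)]
          exact le_of_eq (by congr 1; ring)
        · exact ENNReal.ofReal_ne_top

lemma tendsto_ofReal_div_succ (K : ℝ) :
    Filter.Tendsto (fun n : ℕ => ENNReal.ofReal (K / (n + 1))) Filter.atTop (nhds 0) := by
  have := ENNReal.tendsto_ofReal (tendsto_const_div_atTop_nhds_zero_nat K |>.comp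
    (Filter.tendsto_add_atTop_nat 1))
  simpa [Function.comp_def] using this

/-- The quadratic weight is at least 1, so the probability that epoch `n` occurs by time `t` is
O(1/n). -/
lemma IsClockSystem.ae_exists_epoch_gt
    (hξ : IsClockSystem μ (constDiffMatrix a) x₀ ξ) (hten : Tenable (constDiffMatrix a) x₀)
    (hΔ : x₀ 1 - x₀ 0 = Δ) (hΔ0 : 0 < Δ) (t : ℝ) :
    ∀ᵐ ω ∂μ, ∃ n, t < (epoch (constDiffMatrix a) x₀ (fun m p => ξ m p ω) n).1 := by
  obtain ⟨K, hK⟩ := hξ.lintegral_sq_early_le hten hΔ hΔ0 t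
  rw [ae_iff]
  refine le_antisymm (ge_of_tendsto' (tendsto_ofReal_div_succ K) fun n => ?_) zero_le
  have hm : MeasurableSet {ω | (epoch (constDiffMatrix a) x₀ (fun m p => ξ m p ω) n).1 ≤ t} :=
    measurableSet_le (measurable_epoch hξ.measurable n).fst measurable_const
  calc _ ≤ μ {ω | (epoch (constDiffMatrix a) x₀ (fun m p => ξ m p ω) n).1 ≤ t} :=
        measure_mono fun ω hω => by
          simp only [Set.mem_ofPred_eq, not_exists, not_lt] at hω
          exact hω n
    _ = ∫⁻ ω, Set.indicator {ω | (epoch (constDiffMatrix a) x₀ (fun m p => ξ m p ω) n).1 ≤ t}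
          1 ω ∂μ := (lintegral_indicator_one hm).symm
    _ ≤ _ := by
        refine (lintegral_mono fun ω => ?_).trans (hK n)
        have hx0 : (0 : ℝ) ≤ (epoch (constDiffMatrix a) x₀ (fun m p => ξ m p ω) n).2 0 := by
          exact_mod_cast (hten _ (reachable_epoch hten _ n)).1 0
        simp only [Set.indicator_apply, Set.mem_ofPred_eq, Pi.one_apply]
        split_ifs
        · rw [ENNReal.one_le_ofReal]
          exact one_le_pow₀ (by linarith)
        · exact le_rfl

/-- The expectation at time `t` of the final values of a solution of the backward equation. -/
lemma IsClockSystem.lintegral_final_value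
    (hξ : IsClockSystem μ (constDiffMatrix a) x₀ ξ) (hten : Tenable (constDiffMatrix a) x₀)
    (hΔ : x₀ 1 - x₀ 0 = Δ) (hΔ0 : 0 < Δ) {h : ℝ → ℝ → ℝ} (hh : IsBackwardSolution a Δ h)
    {t : ℝ} (ht : 0 ≤ t) {C : ℝ}
    (hC : 0 ≤ C) (hbd : ∀ v x, 0 ≤ v → v ≤ t → 0 ≤ x → h v x ≤ C * (1 + x) ^ 2) :
    ∫⁻ ω, ENNReal.ofReal
        (h 0 (urnAt (constDiffMatrix a) x₀ (fun m p => ξ m p ω) t 0)) ∂μ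
      = ENNReal.ofReal (h t (x₀ 0)) := by
  rw [hξ.lintegral_urnAt ht (hξ.ae_exists_epoch_gt hten hΔ hΔ0 t)
    fun x => ENNReal.ofReal (h 0 (x 0))]
  obtain ⟨K, hK⟩ := hξ.lintegral_sq_early_le hten hΔ hΔ0 t
  set Z : ℕ → Ω → ℝ × Urn := fun n ω => epoch (constDiffMatrix a) x₀ (fun m p => ξ m p ω) n
  set D : ℕ → ℝ≥0∞ := fun n => ∫⁻ ω, if (Z n ω).1 ≤ t ∧ t < (Z (n + 1) ω).1 then
    ENNReal.ofReal (h 0 ((Z n ω).2 0)) else 0 ∂μ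
  set A : ℕ → ℝ≥0∞ := fun n => ∫⁻ ω, if (Z n ω).1 ≤ t then
    ENNReal.ofReal (h (t - (Z n ω).1) ((Z n ω).2 0)) else 0 ∂μ
  have hstep : ∀ n, A n = A (n + 1) + D n := fun n =>
    hξ.lintegral_backward_step hten hΔ hΔ0 hh t n rfl rfl
  have h0 : A 0 = ENNReal.ofReal (h t (x₀ 0)) := by simp [A, Z, epoch, ht]
  -- Telescoping; the remainder `A n` vanishes in the limit by the quadratic bound `hbd`.
  have hsum : ∀ n, ∑ k ∈ Finset.range n, D k + A n = A 0 := by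
    intro n
    induction n with
    | zero => simp
    | succ n ih => rw [Finset.sum_range_succ, add_assoc, add_comm (D n), ← hstep, ih]
  have hA : ∀ n : ℕ, A n ≤ ENNReal.ofReal C * ENNReal.ofReal (K / (n + 1)) := by
    intro n
    refine le_trans ?_ (mul_le_mul_right (hK n) _)
    rw [← lintegral_const_mul' _ _ ENNReal.ofReal_ne_top]
    refine lintegral_mono_ae ?_
    filter_upwards [hξ.ae_nonneg] with ω hω
    change (if (Z n ω).1 ≤ t then _ else _) ≤ ENNReal.ofReal C * (if (Z n ω).1 ≤ t then _ else _)
    split_ifs with hs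
    · rw [← ENNReal.ofReal_mul hC]
      refine ENNReal.ofReal_le_ofReal (hbd _ _ (sub_nonneg.2 hs) ?_ ?_)
      · have : (0 : ℝ) ≤ (Z n ω).1 := monotone_epoch hω (Nat.zero_le n)
        linarith
      · exact_mod_cast (hten _ (reachable_epoch hten _ n)).1 0
    · simp
  have hA0 : Filter.Tendsto A Filter.atTop (nhds 0) := by
    have := ENNReal.Tendsto.const_mul (a := ENNReal.ofReal C) (tendsto_ofReal_div_succ K)
      (.inr ENNReal.ofReal_ne_top)
    rw [mul_zero] at this
    exact tendsto_of_tendsto_of_tendsto_of_le_of_le tendsto_const_nhds this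
      (fun _ => zero_le) hA
  have hlim := (ENNReal.tendsto_nat_tsum D).add hA0
  simp only [hsum, add_zero] at hlim
  rw [← h0]
  exact tendsto_nhds_unique hlim tendsto_const_nhds

end ConstDiff

end PolyaProcess

/-! ### The mean and the variance -/

theorem mainTheorem2 {Ω : Type*} [MeasurableSpace Ω] (μ : Measure Ω) [IsProbabilityMeasure μ]
    (a : ℕ) (ha : 1 ≤ a) (w₀ b₀ : ℕ) (Δ : ℤ) (hΔ : Δ = b₀ - w₀) (hΔ1 : 1 ≤ Δ)
    (hten : PolyaProcess.Tenable (PolyaProcess.constDiffMatrix a) ![(w₀ : ℤ), (b₀ : ℤ)])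
    (ξ : ℕ → PolyaProcess.Ball → Ω → ℝ)
    (hξ : PolyaProcess.IsClockSystem μ (PolyaProcess.constDiffMatrix a) ![(w₀ : ℤ), (b₀ : ℤ)] ξ)
    (W : ℝ → Ω → ℝ)
    (hW : ∀ t ω, W t ω = (PolyaProcess.urnAt (PolyaProcess.constDiffMatrix a)
      ![(w₀ : ℤ), (b₀ : ℤ)] (fun n p => ξ n p ω) t 0 : ℝ))
    (t : ℝ) (ht : 0 ≤ t) :
    MemLp (W t) 2 μ ∧
      ∫ ω, W t ω ∂μ = w₀ + a * Δ * t ∧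
      variance (W t) μ = (a : ℝ) ^ 2 * t * (2 * w₀ + Δ + a * Δ * t) := by
  have hΔ' : (![(w₀ : ℤ), (b₀ : ℤ)] : PolyaProcess.Urn) 1 -
      (![(w₀ : ℤ), (b₀ : ℤ)] : PolyaProcess.Urn) 0 = Δ := by simp [hΔ]
  have hΔ0 : 0 < Δ := by omega
  have hΔr : (0 : ℝ) ≤ Δ := by exact_mod_cast hΔ0.le
  have har : (0 : ℝ) ≤ a := Nat.cast_nonneg a
  have hmeas : AEMeasurable (W t) μ := by
    have h1 : Measurable fun x : PolyaProcess.Urn => (x 0 : ℝ) := measurable_of_countable _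
    rw [funext (hW t)]
    exact h1.comp_aemeasurable
      (hξ.aemeasurable_urnAt ht (hξ.ae_exists_epoch_gt hten hΔ' hΔ0 t))
  have hnn : ∀ ω, 0 ≤ W t ω := fun ω => by
    rw [hW]
    exact_mod_cast (hten _ (PolyaProcess.reachable_epoch hten _ _)).1 0
  have hmean : ∫⁻ ω, ENNReal.ofReal (W t ω) ∂μ = ENNReal.ofReal (w₀ + a * Δ * t) := by
    have := hξ.lintegral_final_value hten hΔ' hΔ0
      (PolyaProcess.isBackwardSolution_mean har hΔr) ht (C := 1 + a * Δ * t) (by positivity)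
      (fun v x hv hvt hx => by
        have h1 : a * Δ * v ≤ a * Δ * t := by gcongr
        have h2 : 0 ≤ a * Δ * t := by positivity
        nlinarith [mul_nonneg h2 hx, mul_nonneg h2 (mul_nonneg hx hx)])
    simpa [hW] using this
  have hsq : ∫⁻ ω, ENNReal.ofReal (W t ω ^ 2) ∂μ = ENNReal.ofReal
      ((w₀ + a * Δ * t) ^ 2 + a ^ 2 * t * (2 * w₀ + Δ + a * Δ * t)) := by
    have := hξ.lintegral_final_value hten hΔ' hΔ0
      (PolyaProcess.isBackwardSolution_secondMoment har hΔr) ht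
      (C := (1 + a * Δ * t) ^ 2 + a ^ 2 * t * (2 + Δ + a * Δ * t)) (by positivity)
      (fun v x hv hvt hx => by
        have h1 : a * Δ * v ≤ a * Δ * t := by gcongr
        have h2 : 0 ≤ a * Δ * t := by positivity
        have h3 : x + a * Δ * v ≤ (1 + a * Δ * t) * (1 + x) := by nlinarith [mul_nonneg h2 hx]
        have h4 : (2 * x + Δ + a * Δ * v) ≤ (2 + Δ + a * Δ * t) * (1 + x) ^ 2 := by
          have h5 : 2 * x + Δ + a * Δ * v ≤ (2 + Δ + a * Δ * t) * (1 + x) := by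
            nlinarith [mul_nonneg h2 hx, mul_nonneg hΔr hx]
          refine h5.trans ?_
          have : 1 + x ≤ (1 + x) ^ 2 := le_self_pow₀ (by linarith) (by norm_num)
          gcongr
        have h6 : (x + a * Δ * v) ^ 2 ≤ ((1 + a * Δ * t) * (1 + x)) ^ 2 := by gcongr
        have h7 : a ^ 2 * v * (2 * x + Δ + a * Δ * v)
            ≤ a ^ 2 * t * ((2 + Δ + a * Δ * t) * (1 + x) ^ 2) := by gcongr
        calc _ ≤ _ := add_le_add h6 h7
          _ = _ := by ring)
    simpa [hW] using this
  -- The second moment, computed as a lower integral, is finite; this is what allows the passage to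
  -- Bochner integrals.
  have hLp : MemLp (W t) 2 μ := by
    rw [memLp_two_iff_integrable_sq hmeas.aestronglyMeasurable]
    refine ⟨(hmeas.pow_const 2).aestronglyMeasurable, ?_⟩
    rw [hasFiniteIntegral_iff_ofReal (.of_forall fun ω => sq_nonneg _), hsq]
    exact ENNReal.ofReal_lt_top
  have hE : ∫ ω, W t ω ∂μ = w₀ + a * Δ * t := by
    rw [integral_eq_lintegral_of_nonneg_ae (.of_forall hnn) hmeas.aestronglyMeasurable, hmean,
      ENNReal.toReal_ofReal (by positivity)]
  refine ⟨hLp, hE, ?_⟩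
  have hE2 : ∫ ω, W t ω ^ 2 ∂μ
      = (w₀ + a * Δ * t) ^ 2 + a ^ 2 * t * (2 * w₀ + Δ + a * Δ * t) := by
    rw [integral_eq_lintegral_of_nonneg_ae (.of_forall fun ω => sq_nonneg _)
      (hmeas.pow_const 2).aestronglyMeasurable, hsq, ENNReal.toReal_ofReal (by positivity)]
  rw [variance_eq_sub hLp, hE]
  simp only [Pi.pow_apply, hE2]
  ring
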